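/- **Model.** A network is a connected undirected graph on $n$ nodes with diameter $D$; communication takes place in synchronous rounds, and in each round every node either listens or transmits. In a *radio network with collision detection* a transmission is a packet of a fixed number of bits; a listening node perceives silence if none of its neighbors transmits, receives the packet if exactly one neighbor transmits, and detects a collision if at least two do. In a *beep network* a transmission is a beep, and a listening node only learns whether at least one of its neighbors beeps. A transmitting node learns nothing in that round. Each node independently samples a uniform $b$-bit identifier and has an independent private random tape. All nodes run the same protocol, which may depend on $n$, $D$, $b$ and the packet length: the action and the output of a node depend only on its identifier, its tape, and what it has perceived since it woke up. Either all nodes are awake from round $0$ (synchronous wake-up), or an arbitrary nonempty set of nodes is awake initially and each other node listens until it is woken up by the first round in which it does not perceive silence (arbitrary wake-up). For $c>0$, a protocol *solves leader election for $(n,D)$ in $T$ rounds with probability at least $1-n^{-c}$* if, on every connected $n$-node network of diameter $D$ and for every allowed set of initially awake nodes, with at least this probability all nodes output after $T$ rounds one and the same identifier, which is the identifier of a node of the network. **Statement.** For every constant $c>0$ there are $\kappa>0$ and $n_0$, depending only on $c$, such that the following holds in radio networks with collision detection (with any packet length) and in beep networks, under synchronous as well as under arbitrary wake-up. Let $n\ge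 n_0$, $1\le D\le n-1$, and let $b$ be such that $n$ independent uniform $b$-bit identifiers are pairwise distinct with probability at least $1-n^{-c}$. Then every randomized protocol that solves leader election for $(n,D)$ in $T$ rounds with probability at least $1-n^{-c}$ satisfies $$T\ \ge\ \kappa\,(D+\log n).$$ That is, leader election with high probability requires $\Omega(D+\log n)$ rounds. -/

import Mathlib

open MeasureTheory

namespace RadioNetwork

/-- The two communication models: radio networks with collision detection, in which a transmission
is a packet of `packetBits` bits, and beep networks, in which a transmission is a bare beep. -/
inductive Model where
  | radioCD (packetBits : ℕ)
  | beep

/-- What one transmission can carry. A beep carries no information. -/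
def Model.Packet : Model → Type
  | .radioCD p => Fin p → Bool
  | .beep => Unit

/-- What a node perceives in one round: `own` (it transmitted itself and learns nothing), silence,
a received packet, a detected collision, or, in beep networks, a heard beep. -/
inductive Obs (M : Type) where
  | own
  | silence
  | packet (m : M)
  | collision
  | beep

open Classical in
/-- The observation of node `v` in a round of a radio network with collision detection in which
node `u` performs the action `a u` (`none`: listen, `some m`: transmit the packet `m`). -/
noncomputable def radioObs {V M : Type} (G : SimpleGraph V) (a : V → Option M) (v : V) : Obs M :=
  if (a v).isSome then .own
  else if h : ∃! u, G.Adj v u ∧ (a u).isSome then .packet ((a h.choose).get h.choose_spec.1.2)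
  else if ∃ u, G.Adj v u ∧ (a u).isSome then .collision
  else .silence

open Classical in
/-- The observation of node `v` in a round of a beep network in which node `u` beeps if and only if
`a u` is not `none`. -/
noncomputable def beepObs {V M : Type} (G : SimpleGraph V) (a : V → Option M) (v : V) : Obs M :=
  if (a v).isSome then .own
  else if ∃ u, G.Adj v u ∧ (a u).isSome then .beep
  else .silence

/-- The observation of node `v` in one round, in the given model. -/
noncomputable def Model.observe (model : Model) {V : Type} (G : SimpleGraph V)
    (a : V → Option model.Packet) (v : V) : Obs model.Packet :=
  match model with
  | .radioCD _ => radioObs G a v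
  | .beep => beepObs G a v

/-- Identifiers of `b` bits. -/
abbrev ID (b : ℕ) : Type := Fin b → Bool

/-- The uniform distribution on identifiers of `b` bits. -/
noncomputable def idLaw (b : ℕ) : Measure (ID b) := (PMF.uniformOfFintype (ID b)).toMeasure

/-- If `n` nodes independently sample uniform identifiers of `b` bits, these are pairwise distinct
with probability at least `1 - n ^ (-c)`. -/
def IDsUniqueWHP (n b : ℕ) (c : ℝ) : Prop :=
  1 - (n : ℝ) ^ (-c) ≤
    (Measure.pi fun _ : Fin n => idLaw b).real {ids | Function.Injective ids}

/-- A randomized distributed protocol, run by all nodes. Each node has a private random tape drawn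
from `law`. What it does next (`act`: listen or transmit) and what it currently outputs (`out`:
nothing yet, or an identifier) is determined by its own identifier, its own tape, and the list of
its observations since it woke up, the latest one first. -/
structure Protocol (model : Model) (b : ℕ) where
  Tape : Type
  [mTape : MeasurableSpace Tape]
  law : Measure Tape
  [prob : IsProbabilityMeasure law]
  act : ID b → Tape → List (Obs model.Packet) → Option model.Packet
  out : ID b → Tape → List (Obs model.Packet) → Option (ID b)
  measurable_act : ∀ i h a, MeasurableSet {ω | act i ω h = a}
  measurable_out : ∀ i h x, MeasurableSet {ω | out i ω h = x}

attribute [instance] Protocol.mTape Protocol.prob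

/-- Which sets of nodes may be awake in round zero: all nodes, or an arbitrary nonempty set. -/
inductive WakeUp where
  | synchronous
  | arbitrary

/-- `wake.Allows W`: the set `W` of initially awake nodes is allowed. -/
def WakeUp.Allows {V : Type} : WakeUp → Set V → Prop
  | .synchronous, W => W = Set.univ
  | .arbitrary, W => W.Nonempty

namespace Protocol

variable {model : Model} {b : ℕ}

open Classical in
/-- The observations of node `v` since it woke up, after `r` rounds in the network `G`, where the
nodes of `W` are awake initially and `s u` is the identifier and the tape of node `u`. The value is
`none` while `v` is asleep. A sleeping node listens, and is woken up by the first round in which it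
does not perceive silence. -/
noncomputable def view (P : Protocol model b) {V : Type} (G : SimpleGraph V) (W : Set V)
    (s : V → ID b × P.Tape) : ℕ → V → Option (List (Obs model.Packet))
  | 0, v => if v ∈ W then some [] else none
  | r + 1, v =>
    let o := model.observe G
      (fun u => (P.view G W s r u).bind fun h => P.act (s u).1 (s u).2 h) v
    match P.view G W s r v with
    | some h => some (o :: h)
    | none => if o = .silence then none else some [o]

/-- What node `v` outputs after `r` rounds, if anything. -/
noncomputable def output (P : Protocol model b) {V : Type} (G : SimpleGraph V) (W : Set V)
    (s : V → ID b × P.Tape) (r : ℕ) (v : V) : Option (ID b) :=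
  (P.view G W s r v).bind fun h => P.out (s v).1 (s v).2 h

/-- A leader is elected after `T` rounds: all nodes output one and the same identifier, and it is
the identifier of a node of the network. -/
def Elects (P : Protocol model b) {V : Type} (G : SimpleGraph V) (W : Set V) (T : ℕ)
    (s : V → ID b × P.Tape) : Prop :=
  ∃ x : ID b, (∃ u, (s u).1 = x) ∧ ∀ v, P.output G W s T v = some x

/-- The joint law of identifiers and tapes of `n` nodes: all of them are independent. -/
noncomputable def seedLaw (P : Protocol model b) (n : ℕ) : Measure (Fin n → ID b × P.Tape) :=
  Measure.pi fun _ => (idLaw b).prod P.law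

/-- The protocol solves leader election on `n`-node networks of diameter `D` within `T` rounds with
probability at least `1 - n ^ (-c)`: this holds for every connected network with these parameters
and every allowed set of initially awake nodes. -/
def SolvesLeaderElection (P : Protocol model b) (wake : WakeUp) (n D T : ℕ) (c : ℝ) : Prop :=
  ∀ G : SimpleGraph (Fin n), G.Connected → G.diam = D →
    ∀ W : Set (Fin n), wake.Allows W →
      1 - (n : ℝ) ^ (-c) ≤ (P.seedLaw n).real {s | P.Elects G W T s}

end Protocol

end RadioNetwork

/-!
**Idea.** With all nodes awake from the start, what a node sees in `T` rounds is a function of the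
seeds within distance `T`. The leader's identifier is independent of a node's observations if it is
not within that distance, and since an identifier takes a given value with probability only
`2 ^ (-b) = O(n ^ (-c) / n)`, nobody can guess it. On a graph of diameter `D > 2 * T` every
possible leader is out of sight of one of two extreme nodes, hence `T = Ω(D)`.

For `T = Ω(log n)`, consider a node that never receives a packet. It makes one of four observations
per round, so that its output is one of `4 ^ T` values determined by its own seed, and it can name
another node as the leader only with probability `O(4 ^ T * n ^ (-c))`. In a beep network there are
no packets at all. In a radio network, let the first two layers of a layered graph consist of three
copies of one block, each with its own independent seeds, and compare the run with the three
symmetric runs in which all copies use the seeds of one of them. In a symmetric run a transmission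
in the first two layers is always doubled by the other copies, so it is heard as a collision and its
content is lost. The first two layers thus influence each other and the rest only through the two
bits per round telling which of them are busy. If these `2 * T` bits coincide in the three symmetric
runs, which has probability at least `16 ^ (-T)` by the power mean inequality, then the actual run
agrees with each of them, and no node of layer `0` receives a packet. Two such nodes cannot both be
the leader, so `16 ^ (-T) ≤ O(4 ^ T * n ^ (-c))`.
-/

namespace RadioNetwork

section Probability

variable {Z Y : Type*} [MeasurableSpace Z] [MeasurableSpace Y]

theorem measureReal_prod_eq_integral {ν : Measure Z} {ρ : Measure Y} [IsProbabilityMeasure ν]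
    [IsProbabilityMeasure ρ] {E : Set (Z × Y)} (hE : MeasurableSet E) :
    (ν.prod ρ).real E = ∫ z, ρ.real (Prod.mk z ⁻¹' E) ∂ν := by
  simp only [Measure.real]
  rw [Measure.prod_apply hE, integral_toReal (measurable_measure_prodMk_left hE).aemeasurable
    (.of_forall fun z => measure_lt_top ρ _)]

theorem measureReal_prod_le {ν : Measure Z} {ρ : Measure Y} [IsProbabilityMeasure ν]
    [IsProbabilityMeasure ρ] {E : Set (Z × Y)} (hE : MeasurableSet E) {a : ℝ}
    (h : ∀ z, ρ.real (Prod.mk z ⁻¹' E) ≤ a) : (ν.prod ρ).real E ≤ a := by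
  rw [measureReal_prod_eq_integral hE]
  simpa using integral_mono (μ := ν)
    (Measure.integrable_measure_prodMk_left hE (measure_ne_top _ _)) (integrable_const a) h

theorem le_measureReal_prod {ν : Measure Z} {ρ : Measure Y} [IsProbabilityMeasure ν]
    [IsProbabilityMeasure ρ] {E : Set (Z × Y)} (hE : MeasurableSet E) {a : ℝ}
    (h : ∀ z, a ≤ ρ.real (Prod.mk z ⁻¹' E)) : a ≤ (ν.prod ρ).real E := by
  rw [measureReal_prod_eq_integral hE]
  simpa using integral_mono (μ := ν) (integrable_const a)
    (Measure.integrable_measure_prodMk_left hE (measure_ne_top _ _)) h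

variable {V : Type*} [Fintype V] {S : V → Type*} [∀ v, MeasurableSpace (S v)]
  {μ : ∀ v, Measure (S v)} [∀ v, IsProbabilityMeasure (μ v)]

theorem measurePreserving_update [DecidableEq V] (w : V) :
    MeasurePreserving (fun p : (∀ v, S v) × S w => Function.update p.1 w p.2)
      ((Measure.pi μ).prod (μ w)) (Measure.pi μ) := by
  refine ⟨by fun_prop, (Measure.pi_eq fun B hB => ?_).symm⟩
  have preimage_eq : (fun p : (∀ v, S v) × S w => Function.update p.1 w p.2) ⁻¹' Set.univ.pi B =
      Set.univ.pi (Function.update B w Set.univ) ×ˢ B w := by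
    ext p
    simp only [Set.mem_preimage, Set.mem_pi, Set.mem_univ, true_imp_iff, Set.mem_prod,
      Function.forall_update_iff B (fun v b => p.1 v ∈ b),
      Function.forall_update_iff p.1 (fun v x => x ∈ B v), true_and, and_comm]
  rw [Measure.map_apply (by fun_prop) (.univ_pi hB), preimage_eq, Measure.prod_prod, Measure.pi_pi,
    ← Finset.prod_erase_mul _ _ (Finset.mem_univ w),
    ← Finset.prod_erase_mul _ (fun v => μ v (B v)) (Finset.mem_univ w)]
  simp only [Function.update_self, measure_univ, mul_one]
  congr 1
  refine Finset.prod_congr rfl fun v hv => ?_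
  rw [Function.update_of_ne (Finset.ne_of_mem_erase hv)]

theorem measureReal_pi_le_of_update [DecidableEq V] (w : V) {E : Set (∀ v, S v)}
    (hE : MeasurableSet E) {a : ℝ} (h : ∀ s, (μ w).real {x | Function.update s w x ∈ E} ≤ a) :
    (Measure.pi μ).real E ≤ a := by
  rw [← (measurePreserving_update w).measureReal_preimage hE.nullMeasurableSet]
  exact measureReal_prod_le ((measurePreserving_update (μ := μ) w).measurable hE) h

end Probability

/-- The family indexed by `V` whose entry at `v` is read off from `t` or `z` according to the value
of `j v`: `j` exhibits `V` as made of `κ` copies of `A` and a remainder `B`. -/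
def assemble {κ A B V S : Type*} (j : V → (κ × A) ⊕ B) (z : B → S) (t : κ → A → S) : V → S :=
  Sum.elim (Function.uncurry t) z ∘ j

theorem comp_assemble {κ A B V S S' : Type*} (f : S → S') (j : V → (κ × A) ⊕ B) (z : B → S)
    (t : κ → A → S) : f ∘ assemble j z t = assemble j (f ∘ z) fun k => f ∘ t k := by
  funext v
  rcases h : j v <;> simp [assemble, h, Function.uncurry]

section Independence

variable {V : Type*} [Fintype V] {S : Type*} [MeasurableSpace S] {μ : Measure S}
  [IsProbabilityMeasure μ]

theorem measureReal_guess_le [Countable S] [MeasurableSingletonClass S] {I K : Type*} [Fintype K]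
    {label : S → I} {a : ℝ} (hlabel : ∀ i, μ.real (label ⁻¹' {i}) ≤ a)
    {guess : V → (V → S) → K → Option I} (hguess : ∀ w, DependsOn (guess w) {w}ᶜ) :
    (Measure.pi fun _ => μ).real {s : V → S | ∃ w k, guess w s k = some (label (s w))} ≤
      Fintype.card V * (Fintype.card K * a) := by
  classical
  have fixed_guess_le (x : Option I) : μ.real {σ | x = some (label σ)} ≤ a := by
    cases x with
    | none =>
      obtain ⟨σ⟩ := nonempty_of_isProbabilityMeasure μ
      simpa using measureReal_nonneg.trans (hlabel (label σ))
    | some i => simpa [Set.preimage, eq_comm] using hlabel i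
  have single_le (w : V) (k : K) :
      (Measure.pi fun _ => μ).real {s : V → S | guess w s k = some (label (s w))} ≤ a := by
    refine measureReal_pi_le_of_update w (Set.to_countable _).measurableSet fun s => ?_
    have guess_update (σ : S) : guess w (Function.update s w σ) = guess w s :=
      hguess w fun v hv => Function.update_of_ne hv _ _
    simpa [guess_update] using fixed_guess_le (guess w s k)
  simp only [Set.ofPred_exists]
  calc _ ≤ ∑ w : V, ∑ k : K,
        (Measure.pi fun _ => μ).real {s : V → S | guess w s k = some (label (s w))} :=
        (measureReal_iUnion_fintype_le _).trans
          (Finset.sum_le_sum fun w _ => measureReal_iUnion_fintype_le _)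
    _ ≤ ∑ _w : V, ∑ _k : K, a :=
        Finset.sum_le_sum fun w _ => Finset.sum_le_sum fun k _ => single_le w k
    _ = Fintype.card V * (Fintype.card K * a) := by simp

theorem le_measureReal_coincide {O : Type*} [Fintype O] [MeasurableSpace O]
    [MeasurableSingletonClass O] {o : S → O} (ho : Measurable o) (m : ℕ) :
    ((Fintype.card O : ℝ) ^ m)⁻¹ ≤
      (Measure.pi fun _ : Fin (m + 1) => μ).real {t | ∃ c, ∀ k, o (t k) = c} := by
  have fiber (c : O) : {t : Fin (m + 1) → S | ∀ k, o (t k) = c} =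
      Set.univ.pi fun _ => o ⁻¹' {c} := by ext; simp
  have measurable_fiber (c : O) : MeasurableSet (o ⁻¹' {c}) := ho (measurableSet_singleton c)
  have disjoint : Pairwise (Function.onFun Disjoint
      fun c => {t : Fin (m + 1) → S | ∀ k, o (t k) = c}) := fun c c' hne =>
    Set.disjoint_left.2 fun t hc hc' => hne ((hc 0).symm.trans (hc' 0))
  calc ((Fintype.card O : ℝ) ^ m)⁻¹
      = (∑ c : O, μ.real (o ⁻¹' {c})) ^ (m + 1) / (Finset.univ : Finset O).card ^ m := by
        simp [sum_measureReal_preimage_singleton (μ := μ) Finset.univ fun c _ => measurable_fiber c]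
    _ ≤ ∑ c : O, μ.real (o ⁻¹' {c}) ^ (m + 1) :=
        pow_sum_div_card_le_sum_pow (fun _ _ => measureReal_nonneg) m
    _ = _ := by
        rw [Set.ofPred_exists, measureReal_iUnion_fintype disjoint fun c => by
          rw [fiber]; exact .univ_pi fun _ => measurable_fiber c]
        simp [fiber, Measure.real, Measure.pi_pi]

theorem measureReal_injective_le [Countable S] [MeasurableSingletonClass S] {a : ℝ}
    (ha : ∀ x, a ≤ μ.real {x}) (m : ℕ) :
    (Measure.pi fun _ => μ).real {f : Fin (m + 1) → S | Function.Injective f} ≤ (1 - a) ^ m := by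
  have avoid_le (x : S) : (Measure.pi fun _ => μ).real
      {f : Fin m → S | ∀ k, f k ≠ x} ≤ (1 - a) ^ m := by
    have pi_eq : {f : Fin m → S | ∀ k, f k ≠ x} = Set.univ.pi fun _ => {x}ᶜ := by ext; simp
    rw [pi_eq, Measure.real, Measure.pi_pi, ENNReal.toReal_prod]
    simp only [Finset.prod_const, Finset.card_univ, Fintype.card_fin]
    refine pow_le_pow_left₀ ENNReal.toReal_nonneg ?_ m
    linarith [ha x, probReal_compl_eq_one_sub (μ := μ) (measurableSet_singleton x), μ.real_def {x}ᶜ]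
  have split := measurePreserving_piFinSuccAbove (fun _ : Fin (m + 1) => μ) 0
  have hE : MeasurableSet {p : S × (Fin m → S) | ∀ k, p.2 k ≠ p.1} :=
    (Set.to_countable _).measurableSet
  refine (measureReal_mono fun f hf k => ?_).trans
    ((split.measureReal_preimage hE.nullMeasurableSet).trans_le (measureReal_prod_le hE avoid_le))
  exact hf.ne (Fin.succ_ne_zero k)

theorem measurePreserving_comp_of_injective {W : Type*} [Fintype W] {j : W → V}
    (hj : Function.Injective j) :
    MeasurePreserving (fun s : V → S => s ∘ j) (Measure.pi fun _ => μ) (Measure.pi fun _ => μ) := by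
  refine ⟨by fun_prop, ?_⟩
  have indep := (ProbabilityTheory.iIndepFun_pi (μ := fun _ : V => μ) (X := fun _ => id)
    fun _ => aemeasurable_id).precomp hj
  refine (indep.map_fun_eq_pi_map fun w => (measurable_pi_apply _).aemeasurable).trans ?_
  congr 1 with w : 1
  exact (measurePreserving_eval (fun _ => μ) (j w)).map_eq

theorem measurePreserving_uncurry {κ A : Type*} [Fintype κ] [Fintype A] :
    MeasurePreserving (Function.uncurry : (κ → A → S) → κ × A → S)
      (Measure.pi fun _ => Measure.pi fun _ => μ) (Measure.pi fun _ => μ) := by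
  refine ⟨by fun_prop, ?_⟩
  simpa only [Measure.infinitePi_eq_pi, MeasurableEquiv.coe_curry_symm] using
    Measure.infinitePi_map_curry_symm fun (_ : κ) (_ : A) => μ

theorem measurePreserving_assemble {κ A B : Type*} [Fintype κ] [Fintype A] [Fintype B]
    {j : V → (κ × A) ⊕ B} (hj : Function.Injective j) :
    MeasurePreserving (fun p : (B → S) × (κ → A → S) => assemble j p.1 p.2)
      ((Measure.pi fun _ => μ).prod (Measure.pi fun _ => Measure.pi fun _ => μ))
      (Measure.pi fun _ => μ) :=
  (measurePreserving_comp_of_injective hj).comp <|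
    (measurePreserving_sumPiEquivProdPi_symm fun _ => μ).comp <|
      (measurePreserving_uncurry.prod (.id _)).comp Measure.measurePreserving_swap

end Independence

section LayeredGraph

variable {V : Type} {lay : V → ℕ}

/-- The graph in which two distinct nodes are adjacent if and only if their layers differ by at most
one. All lower bounds are obtained on graphs of this form. -/
def layeredGraph (lay : V → ℕ) : SimpleGraph V where
  Adj u v := u ≠ v ∧ lay u ≤ lay v + 1 ∧ lay v ≤ lay u + 1
  symm := ⟨fun _ _ h => ⟨h.1.symm, h.2.2, h.2.1⟩⟩
  loopless := ⟨fun _ h => h.1 rfl⟩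

theorem layeredGraph_adj {u v : V} :
    (layeredGraph lay).Adj u v ↔ u ≠ v ∧ lay u ≤ lay v + 1 ∧ lay v ≤ lay u + 1 :=
  Iff.rfl

theorem layer_le_add_edist (u v : V) : (lay v : ℕ∞) ≤ lay u + (layeredGraph lay).edist u v := by
  by_cases huv : (layeredGraph lay).Reachable u v
  · obtain ⟨p, hp⟩ := huv.exists_walk_length_eq_edist
    have layer_le_add_length {u v : V} (p : (layeredGraph lay).Walk u v) :
        lay v ≤ lay u + p.length := by
      induction p with
      | nil => simp
      | cons h p ih => rw [SimpleGraph.Walk.length_cons]; have := h.2.2; omega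
    rw [← hp]
    exact_mod_cast layer_le_add_length p
  · simp [SimpleGraph.edist_eq_top_of_not_reachable huv]

theorem edist_layeredGraph_le_one {u v : V} (huv : lay u ≤ lay v + 1) (hvu : lay v ≤ lay u + 1) :
    (layeredGraph lay).edist u v ≤ 1 :=
  SimpleGraph.edist_le_one_iff_adj_or_eq.2 <|
    (ne_or_eq u v).imp_left fun hne => layeredGraph_adj.2 ⟨hne, huv, hvu⟩

theorem edist_layeredGraph_le_of_layer_eq_add {d : ℕ} (hd : 1 ≤ d) {u v : V}
    (hv : lay v = lay u + d) (hsurj : ∀ l < lay v, ∃ w, lay w = l) :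
    (layeredGraph lay).edist u v ≤ d := by
  induction d, hd using Nat.le_induction generalizing v with
  | base => exact edist_layeredGraph_le_one (by omega) hv.le
  | succ d _ ih =>
    obtain ⟨w, hw⟩ := hsurj (lay u + d) (by omega)
    calc (layeredGraph lay).edist u v
        ≤ (layeredGraph lay).edist u w + (layeredGraph lay).edist w v :=
          SimpleGraph.edist_triangle
      _ ≤ d + 1 := add_le_add (ih hw fun l hl => hsurj l (by omega))
          (edist_layeredGraph_le_one (by omega) (by omega))
      _ = (d + 1 : ℕ) := by norm_cast

theorem edist_layeredGraph_le {D : ℕ} (hD : 1 ≤ D) (hle : ∀ v, lay v ≤ D)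
    (hsurj : ∀ l ≤ D, ∃ v, lay v = l) (u v : V) : (layeredGraph lay).edist u v ≤ D := by
  wlog huv : lay u ≤ lay v generalizing u v
  · rw [SimpleGraph.edist_comm]
    exact this v u (le_of_not_ge huv)
  rcases huv.eq_or_lt with same | below
  · exact (edist_layeredGraph_le_one (by omega) (by omega)).trans (by exact_mod_cast hD)
  · have hv := hle v
    exact (edist_layeredGraph_le_of_layer_eq_add (d := lay v - lay u) (by omega) (by omega)
      fun l hl => hsurj l (by omega)).trans (by exact_mod_cast (by omega : lay v - lay u ≤ D))

theorem connected_layeredGraph {D : ℕ} (hD : 1 ≤ D) (hle : ∀ v, lay v ≤ D)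
    (hsurj : ∀ l ≤ D, ∃ v, lay v = l) : (layeredGraph lay).Connected := by
  have : Nonempty V := ⟨(hsurj 0 D.zero_le).choose⟩
  exact SimpleGraph.connected_of_ediam_ne_top
    (ne_top_of_le_ne_top (ENat.natCast_ne_top D)
      (SimpleGraph.ediam_le_of_edist_le (edist_layeredGraph_le hD hle hsurj)))

theorem diam_layeredGraph {D : ℕ} (hD : 1 ≤ D) (hle : ∀ v, lay v ≤ D)
    (hsurj : ∀ l ≤ D, ∃ v, lay v = l) : (layeredGraph lay).diam = D := by
  obtain ⟨u, hu⟩ := hsurj 0 D.zero_le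
  obtain ⟨v, hv⟩ := hsurj D le_rfl
  have ediam_eq : (layeredGraph lay).ediam = D :=
    (SimpleGraph.ediam_le_of_edist_le (edist_layeredGraph_le hD hle hsurj)).antisymm <|
      (by simpa [hu, hv] using layer_le_add_edist (lay := lay) u v : (D : ℕ∞) ≤ _).trans
        SimpleGraph.edist_le_ediam
  rw [SimpleGraph.diam, ediam_eq, ENat.toNat_natCast]

end LayeredGraph

section Observation

section radioObs

variable {V M : Type} {G : SimpleGraph V} {a : V → Option M} {u v w : V} {m : M}

theorem radioObs_eq_own (hv : (a v).isSome) : radioObs G a v = .own :=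
  if_pos hv

theorem radioObs_eq_packet (hv : a v = none) (hu : G.Adj v u) (hm : a u = some m)
    (unique : ∀ w, G.Adj v w → (a w).isSome → w = u) : radioObs G a v = .packet m := by
  have h : ∃! u, G.Adj v u ∧ (a u).isSome := ⟨u, ⟨hu, by simp [hm]⟩, fun w hw => unique w hw.1 hw.2⟩
  have choose_eq : h.choose = u := unique _ h.choose_spec.1.1 h.choose_spec.1.2
  rw [radioObs, if_neg (by simp [hv]), dif_pos h]
  simp only [choose_eq, hm, Option.get_some]

theorem radioObs_eq_collision (hv : a v = none) (hu : G.Adj v u) (hw : G.Adj v w) (huw : u ≠ w)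
    (hau : (a u).isSome) (haw : (a w).isSome) : radioObs G a v = .collision := by
  have h : ¬∃! u, G.Adj v u ∧ (a u).isSome := fun h => huw (h.unique ⟨hu, hau⟩ ⟨hw, haw⟩)
  rw [radioObs, if_neg (by simp [hv]), dif_neg h, if_pos ⟨u, hu, hau⟩]

theorem radioObs_eq_silence (hv : a v = none) (h : ∀ u, G.Adj v u → a u = none) :
    radioObs G a v = .silence := by
  have none_transmits : ¬∃ u, G.Adj v u ∧ (a u).isSome := by
    rintro ⟨u, hu, hau⟩
    simp [h u hu] at hau
  rw [radioObs, if_neg (by simp [hv]), dif_neg fun h => none_transmits h.exists,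
    if_neg none_transmits]

theorem radioObs_congr {a' : V → Option M} {v' : V} (hv : a v = none ↔ a' v' = none)
    (h : a v = none → ∀ u m, G.Adj v u ∧ a u = some m ↔ G.Adj v' u ∧ a' u = some m) :
    radioObs G a v = radioObs G a' v' := by
  by_cases hav : a v = none
  swap
  · rw [radioObs_eq_own (Option.isSome_iff_ne_none.2 hav),
      radioObs_eq_own (Option.isSome_iff_ne_none.2 (hv.not.1 hav))]
  have transmits_iff (u : V) : G.Adj v u ∧ (a u).isSome ↔ G.Adj v' u ∧ (a' u).isSome := by
    simp only [Option.isSome_iff_exists, ← exists_and_left, h hav]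
  by_cases hex : ∃! u, G.Adj v u ∧ (a u).isSome
  · obtain ⟨u, ⟨hu, hau⟩, unique⟩ := hex
    obtain ⟨m, hm⟩ := Option.isSome_iff_exists.1 hau
    obtain ⟨hu', hm'⟩ := (h hav u m).1 ⟨hu, hm⟩
    rw [radioObs_eq_packet hav hu hm fun w hw haw => unique w ⟨hw, haw⟩,
      radioObs_eq_packet (hv.1 hav) hu' hm' fun w hw haw =>
        unique w ((transmits_iff w).2 ⟨hw, haw⟩)]
  · rw [radioObs, radioObs, dif_neg hex, dif_neg (by simpa only [transmits_iff] using hex)]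
    rw [hav, hv.1 hav, exists_congr transmits_iff]

theorem beepObs_congr {a' : V → Option M} {v' : V} (hv : a v = none ↔ a' v' = none)
    (h : a v = none → ∀ u m, G.Adj v u ∧ a u = some m ↔ G.Adj v' u ∧ a' u = some m) :
    beepObs G a v = beepObs G a' v' := by
  by_cases hav : a v = none
  · have transmits_iff (u : V) : G.Adj v u ∧ (a u).isSome ↔ G.Adj v' u ∧ (a' u).isSome := by
      simp only [Option.isSome_iff_exists, ← exists_and_left, h hav]
    rw [beepObs, beepObs, hav, hv.1 hav, exists_congr transmits_iff]
  · rw [beepObs, beepObs, if_pos (Option.isSome_iff_ne_none.2 hav),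
      if_pos (Option.isSome_iff_ne_none.2 (hv.not.1 hav))]

end radioObs

theorem observe_congr {model : Model} {V : Type} {G : SimpleGraph V}
    {a a' : V → Option model.Packet} {v v' : V} (hv : a v = none ↔ a' v' = none)
    (h : a v = none → ∀ u m, G.Adj v u ∧ a u = some m ↔ G.Adj v' u ∧ a' u = some m) :
    model.observe G a v = model.observe G a' v' := by
  cases model with
  | radioCD => exact radioObs_congr hv h
  | beep => exact beepObs_congr hv h

/-- The observation is not the reception of a packet; packetless observations carry only two bits
of information. -/
def Obs.Packetless {M : Type} (o : Obs M) : Prop :=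
  ∀ m, o ≠ .packet m

theorem packetless_beepObs {V M : Type} (G : SimpleGraph V) (a : V → Option M) (v : V) :
    (beepObs G a v).Packetless := by
  intro m
  unfold beepObs
  split_ifs <;> simp

/-- The four packetless observations. -/
def bareObs (M : Type) : Fin 4 → Obs M :=
  ![.own, .silence, .collision, .beep]

theorem mem_range_bareObs {M : Type} {o : Obs M} : o ∈ Set.range (bareObs M) ↔ o.Packetless := by
  cases o <;> simp [bareObs, Obs.Packetless]

theorem exists_vector_map_bareObs_eq {M : Type} {l : List (Obs M)} {T : ℕ} (hlen : l.length = T)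
    (hl : ∀ o ∈ l, o.Packetless) :
    ∃ k : List.Vector (Fin 4) T, k.toList.map (bareObs M) = l := by
  obtain ⟨k, rfl⟩ : l ∈ Set.range (List.map (bareObs M)) := by
    rw [Set.range_list_map]
    exact fun o ho => mem_range_bareObs.2 (hl o ho)
  exact ⟨⟨k, by simpa using hlen⟩, rfl⟩

end Observation

section Muffled

variable {V M : Type} {lay : V → ℕ} {a a' : V → Option M} {u v : V}

/-- Some node of layer `l` transmits. -/
def Busy (lay : V → ℕ) (a : V → Option M) (l : ℕ) : Prop :=
  ∃ v, lay v = l ∧ (a v).isSome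

/-- Every transmission in the layers `0` and `1` is accompanied by another one in the same layer, so
that it is never received as a packet. -/
def Muffled (lay : V → ℕ) (a : V → Option M) : Prop :=
  ∀ u, lay u < 2 → (a u).isSome → ∃ w, w ≠ u ∧ lay w = lay u ∧ (a w).isSome

theorem Muffled.radioObs_eq_collision (ha : Muffled lay a) (hv : a v = none)
    (hu : (layeredGraph lay).Adj v u ∧ lay u < 2 ∧ (a u).isSome) :
    radioObs (layeredGraph lay) a v = .collision := by
  obtain ⟨hvu, hlay, hau⟩ := hu
  obtain ⟨w, hwu, hw, haw⟩ := ha u hlay hau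
  have hvw : v ≠ w := by
    rintro rfl
    simp [hv] at haw
  exact RadioNetwork.radioObs_eq_collision hv hvu ⟨hvw, by rw [hw]; exact hvu.2⟩ hwu.symm hau haw

theorem Muffled.packetless_radioObs (ha : Muffled lay a) (hv : lay v = 0) :
    (radioObs (layeredGraph lay) a v).Packetless := by
  intro m
  by_cases hav : a v = none
  swap
  · simp [radioObs_eq_own (Option.isSome_iff_ne_none.2 hav)]
  by_cases h : ∃ u, (layeredGraph lay).Adj v u ∧ (a u).isSome
  · obtain ⟨u, hu, hau⟩ := h
    simp [ha.radioObs_eq_collision hav ⟨hu, by have := hu.2.2; omega, hau⟩]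
  · simp [radioObs_eq_silence hav (by simpa using h)]

theorem exists_lower_transmitter_iff (hv : a v = none) :
    (∃ u, (layeredGraph lay).Adj v u ∧ lay u < 2 ∧ (a u).isSome) ↔
      ∃ l < 2, lay v ≤ l + 1 ∧ l ≤ lay v + 1 ∧ Busy lay a l := by
  constructor
  · rintro ⟨u, hvu, hlay, hau⟩
    exact ⟨lay u, hlay, hvu.2.1, hvu.2.2, u, rfl, hau⟩
  · rintro ⟨_, hlay, hle, hge, u, rfl, hau⟩
    refine ⟨u, ⟨?_, hle, hge⟩, hlay, hau⟩
    rintro rfl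
    simp [hv] at hau

theorem radioObs_eq_of_muffled (ha : Muffled lay a) (ha' : Muffled lay a')
    (busy : ∀ l < 2, Busy lay a l ↔ Busy lay a' l) (hv : a v = a' v)
    (upper : ∀ u, 2 ≤ lay u → a u = a' u) :
    radioObs (layeredGraph lay) a v = radioObs (layeredGraph lay) a' v := by
  by_cases hav : a v = none
  swap
  · exact radioObs_congr (by rw [hv]) fun h => absurd h hav
  have hav' : a' v = none := hv ▸ hav
  have lower_iff : (∃ u, (layeredGraph lay).Adj v u ∧ lay u < 2 ∧ (a u).isSome) ↔
      ∃ u, (layeredGraph lay).Adj v u ∧ lay u < 2 ∧ (a' u).isSome := by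
    rw [exists_lower_transmitter_iff hav, exists_lower_transmitter_iff hav']
    exact exists_congr fun l => and_congr_right fun hl => by rw [busy l hl]
  by_cases lower : ∃ u, (layeredGraph lay).Adj v u ∧ lay u < 2 ∧ (a u).isSome
  · obtain ⟨u, hu⟩ := lower
    obtain ⟨u', hu'⟩ := lower_iff.1 ⟨u, hu⟩
    rw [ha.radioObs_eq_collision hav hu, ha'.radioObs_eq_collision hav' hu']
  · refine radioObs_congr (by rw [hv]) fun _ u m => and_congr_right fun hvu => ?_
    rcases lt_or_ge (lay u) 2 with hlay | hlay
    · have silent : a u = none := by simpa using fun h => lower ⟨u, hvu, hlay, h⟩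
      have silent' : a' u = none := by simpa using fun h => lower (lower_iff.2 ⟨u, hvu, hlay, h⟩)
      rw [silent, silent']
    · rw [upper u hlay]

end Muffled

section Strategy

/-- What remains of a node of the network once its randomness is fixed: its identifier and its
deterministic reaction to each list of observations, the latest observation first. -/
structure Strategy (model : Model) (I : Type) where
  id : I
  act : List (Obs model.Packet) → Option model.Packet
  out : List (Obs model.Packet) → Option I

variable {model : Model} {I V : Type}

/-- The observations of node `v` in the first `r` rounds in the network `G`, where node `u` follows
the strategy `x u` and all nodes are awake from the start. -/
noncomputable def run (G : SimpleGraph V) (x : V → Strategy model I) :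
    ℕ → V → List (Obs model.Packet)
  | 0, _ => []
  | r + 1, v => model.observe G (fun u => (x u).act (run G x r u)) v :: run G x r v

/-- The action of node `v` in round `r`. -/
noncomputable def transmission (G : SimpleGraph V) (x : V → Strategy model I) (r : ℕ) (v : V) :
    Option model.Packet :=
  (x v).act (run G x r v)

/-- All nodes output the identifier of one and the same node after `T` rounds. -/
def Elected (G : SimpleGraph V) (x : V → Strategy model I) (T : ℕ) : Prop :=
  ∃ i, (∃ u, (x u).id = i) ∧ ∀ v, (x v).out (run G x T v) = some i

variable {G : SimpleGraph V} {x x' : V → Strategy model I}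

theorem run_succ (r : ℕ) (v : V) :
    run G x (r + 1) v = model.observe G (transmission G x r) v :: run G x r v :=
  rfl

theorem length_run (r : ℕ) (v : V) : (run G x r v).length = r := by
  induction r with
  | zero => rfl
  | succ r ih => rw [run_succ, List.length_cons, ih]

theorem run_congr_of_edist_le {r : ℕ} {v : V} (h : ∀ u, G.edist v u ≤ r → x u = x' u) :
    run G x r v = run G x' r v := by
  induction r generalizing v with
  | zero => rfl
  | succ r ih =>
    have transmission_eq {u : V} (hu : G.edist v u ≤ 1) :
        transmission G x r u = transmission G x' r u := by
      have within {w : V} (hw : G.edist u w ≤ r) : x w = x' w := by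
        refine h w (SimpleGraph.edist_triangle.trans ((add_le_add hu hw).trans_eq ?_))
        push_cast
        exact add_comm _ _
      rw [transmission, transmission, ih fun w => within, within (by simp)]
    rw [run_succ, run_succ, ih fun u hu => h u (hu.trans (by gcongr; simp))]
    congr 1
    refine observe_congr (by rw [transmission_eq (by simp)]) fun _ u m =>
      and_congr_right fun hvu => ?_
    rw [transmission_eq (SimpleGraph.edist_eq_one_iff_adj.2 hvu).le]

theorem run_congr_of_length_lt {T r : ℕ} (hr : r ≤ T)
    (h : ∀ v l, l.length < T → (x v).act l = (x' v).act l) : run G x r = run G x' r := by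
  induction r with
  | zero => rfl
  | succ r ih =>
    have transmission_eq : transmission G x r = transmission G x' r := by
      funext v
      rw [transmission, transmission, ← ih (by omega), h v _ (by rw [length_run]; omega)]
    funext v
    rw [run_succ, run_succ, transmission_eq, ih (by omega)]

theorem run_eq_of_twins {lay : V → ℕ} {v v' : V} (hlay : lay v = lay v') (hx : x v = x v') (r : ℕ) :
    run (layeredGraph lay) x r v = run (layeredGraph lay) x r v' := by
  induction r with
  | zero => rfl
  | succ r ih =>
    have transmission_eq : transmission (layeredGraph lay) x r v =
        transmission (layeredGraph lay) x r v' := by rw [transmission, transmission, hx, ih]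
    rw [run_succ, run_succ, ih]
    congr 1
    refine observe_congr (by rw [transmission_eq]) fun silent u m => and_congr_left fun hu => ?_
    have hvu : v ≠ u := by rintro rfl; simp [silent] at hu
    have hvu' : v' ≠ u := by rintro rfl; simp [← transmission_eq, silent] at hu
    simp only [layeredGraph_adj, hlay, hvu, hvu', ne_eq, not_false_eq_true, true_and]

/-- Node `v` receives no packet in the first `T` rounds. -/
def ReceivesNoPacket (G : SimpleGraph V) (x : V → Strategy model I) (T : ℕ) (v : V) : Prop :=
  ∀ o ∈ run G x T v, o.Packetless

theorem receivesNoPacket_of_forall_round {T : ℕ} {v : V}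
    (h : ∀ r < T, (model.observe G (transmission G x r) v).Packetless) :
    ReceivesNoPacket G x T v := by
  induction T with
  | zero => simp [ReceivesNoPacket, run]
  | succ T ih =>
    simp only [ReceivesNoPacket, run_succ, List.forall_mem_cons]
    exact ⟨h T (by omega), ih fun r hr => h r (by omega)⟩

end Strategy

section CoreCopies

variable {V A B I : Type} {lay : V → ℕ}

/-- `j` exhibits the nodes of the layers `0` and `1` as three copies of one layered set `A`, of
which the copies `0` and `1` are complete. Nodes of the third copy may be missing, which leaves the
number of nodes in these layers arbitrary. -/
structure CoreCopies (lay : V → ℕ) (j : V → (Fin 3 × A) ⊕ B) : Prop where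
  injective : Function.Injective j
  exists_inl_iff : ∀ v, (∃ k a, j v = .inl (k, a)) ↔ lay v < 2
  layer_eq : ∀ {v w k l a}, j v = .inl (k, a) → j w = .inl (l, a) → lay v = lay w
  exists_eq_inl : ∀ k ≠ 2, ∀ a, ∃ v, j v = .inl (k, a)

/-- The node `v` lies in copy `k`, or in no copy at all. -/
def AvoidsOtherCopies (j : V → (Fin 3 × A) ⊕ B) (k : Fin 3) (v : V) : Prop :=
  ∀ l a, j v = .inl (l, a) → l = k

variable {j : V → (Fin 3 × A) ⊕ B}

theorem avoidsOtherCopies_of_eq_inl {k : Fin 3} {a : A} {v : V} (hv : j v = .inl (k, a)) :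
    AvoidsOtherCopies j k v := by
  intro l a' h
  simp_all

theorem CoreCopies.avoidsOtherCopies_of_le_layer (hj : CoreCopies lay j) (k : Fin 3) {v : V}
    (hv : 2 ≤ lay v) : AvoidsOtherCopies j k v :=
  fun l a h => absurd ((hj.exists_inl_iff v).1 ⟨l, a, h⟩) hv.not_gt

theorem assemble_eq_of_avoidsOtherCopies {S : Type} {z : B → S} {t : Fin 3 → A → S} {k : Fin 3}
    {v : V} (hv : AvoidsOtherCopies j k v) : assemble j z t v = assemble j z (fun _ => t k) v := by
  rcases h : j v with ⟨l, a⟩ | b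
  · simp [assemble, h, hv l a h]
  · simp [assemble, h]

variable {model : Model}

theorem CoreCopies.transmission_eq (hj : CoreCopies lay j) {z : B → Strategy model I}
    {τ : A → Strategy model I} {r : ℕ} {k k' : Fin 3} {a : A} {v w : V} (hv : j v = .inl (k, a))
    (hw : j w = .inl (k', a)) :
    transmission (layeredGraph lay) (assemble j z fun _ => τ) r v =
      transmission (layeredGraph lay) (assemble j z fun _ => τ) r w := by
  have twins : assemble j z (fun _ => τ) v = assemble j z (fun _ => τ) w := by
    simp [assemble, hv, hw]
  rw [transmission, transmission, run_eq_of_twins (hj.layer_eq hv hw) twins, twins]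

theorem CoreCopies.exists_transmitter_of_busy (hj : CoreCopies lay j) {z : B → Strategy model I}
    {τ : A → Strategy model I} {r l : ℕ} (hl : l < 2)
    (busy : Busy lay (transmission (layeredGraph lay) (assemble j z fun _ => τ) r) l)
    {k : Fin 3} (hk : k ≠ 2) :
    ∃ v a, j v = .inl (k, a) ∧ lay v = l ∧
      (transmission (layeredGraph lay) (assemble j z fun _ => τ) r v).isSome := by
  obtain ⟨u, hlay, hu⟩ := busy
  obtain ⟨k', a, hua⟩ := (hj.exists_inl_iff u).2 (by omega)
  obtain ⟨v, hv⟩ := hj.exists_eq_inl k hk a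
  exact ⟨v, a, hv, (hj.layer_eq hv hua).trans hlay, hj.transmission_eq hv hua ▸ hu⟩

theorem muffled_of_forall_exists_copy {M : Type} {act : V → Option M}
    (h : ∀ l < 2, Busy lay act l → ∀ k ≠ 2, ∃ v a, j v = .inl (k, a) ∧ lay v = l ∧ (act v).isSome) :
    Muffled lay act := by
  intro u hlay hu
  obtain ⟨v, a, hv, hlay_v, hact_v⟩ := h _ hlay ⟨u, rfl, hu⟩ 0 (by decide)
  obtain ⟨w, a', hw, hlay_w, hact_w⟩ := h _ hlay ⟨u, rfl, hu⟩ 1 (by decide)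
  by_cases hvu : v = u
  · refine ⟨w, ?_, hlay_w, hact_w⟩
    rintro rfl
    simp [hvu, hw] at hv
  · exact ⟨v, hvu, hlay_v, hact_v⟩

section Mixed

variable {z : B → Strategy model I} {t : Fin 3 → A → Strategy model I} {r : ℕ}

theorem transmission_assemble_eq (agree : ∀ k v, AvoidsOtherCopies j k v →
      run (layeredGraph lay) (assemble j z t) r v =
        run (layeredGraph lay) (assemble j z fun _ => t k) r v)
    {k : Fin 3} {v : V} (hv : AvoidsOtherCopies j k v) :
    transmission (layeredGraph lay) (assemble j z t) r v =
      transmission (layeredGraph lay) (assemble j z fun _ => t k) r v := by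
  rw [transmission, transmission, agree k v hv, assemble_eq_of_avoidsOtherCopies hv]

theorem CoreCopies.exists_transmitter_assemble (hj : CoreCopies lay j)
    (agree : ∀ k v, AvoidsOtherCopies j k v →
      run (layeredGraph lay) (assemble j z t) r v =
        run (layeredGraph lay) (assemble j z fun _ => t k) r v)
    (busy : ∀ k k', ∀ l < 2,
      Busy lay (transmission (layeredGraph lay) (assemble j z fun _ => t k) r) l ↔
        Busy lay (transmission (layeredGraph lay) (assemble j z fun _ => t k') r) l)
    {l : ℕ} (hl : l < 2) {k : Fin 3}
    (hbusy : Busy lay (transmission (layeredGraph lay) (assemble j z fun _ => t k) r) l)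
    {k' : Fin 3} (hk' : k' ≠ 2) :
    ∃ v a, j v = .inl (k', a) ∧ lay v = l ∧
      (transmission (layeredGraph lay) (assemble j z t) r v).isSome := by
  obtain ⟨v, a, hv, hlay, hact⟩ := hj.exists_transmitter_of_busy hl ((busy k k' l hl).1 hbusy) hk'
  refine ⟨v, a, hv, hlay, ?_⟩
  rwa [transmission_assemble_eq agree (avoidsOtherCopies_of_eq_inl hv)]

theorem CoreCopies.busy_assemble_iff (hj : CoreCopies lay j)
    (agree : ∀ k v, AvoidsOtherCopies j k v →
      run (layeredGraph lay) (assemble j z t) r v =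
        run (layeredGraph lay) (assemble j z fun _ => t k) r v)
    (busy : ∀ k k', ∀ l < 2,
      Busy lay (transmission (layeredGraph lay) (assemble j z fun _ => t k) r) l ↔
        Busy lay (transmission (layeredGraph lay) (assemble j z fun _ => t k') r) l)
    {l : ℕ} (hl : l < 2) (k : Fin 3) :
    Busy lay (transmission (layeredGraph lay) (assemble j z t) r) l ↔
      Busy lay (transmission (layeredGraph lay) (assemble j z fun _ => t k) r) l := by
  constructor
  · rintro ⟨v, hlay, hact⟩
    obtain ⟨k', a, hv⟩ := (hj.exists_inl_iff v).2 (by omega)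
    rw [transmission_assemble_eq agree (avoidsOtherCopies_of_eq_inl hv)] at hact
    exact (busy k' k l hl).1 ⟨v, hlay, hact⟩
  · intro hbusy
    obtain ⟨v, a, -, hlay, hact⟩ :=
      hj.exists_transmitter_assemble agree busy hl hbusy (k' := 0) (by decide)
    exact ⟨v, hlay, hact⟩

theorem CoreCopies.muffled_assemble (hj : CoreCopies lay j)
    (agree : ∀ k v, AvoidsOtherCopies j k v →
      run (layeredGraph lay) (assemble j z t) r v =
        run (layeredGraph lay) (assemble j z fun _ => t k) r v)
    (busy : ∀ k k', ∀ l < 2,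
      Busy lay (transmission (layeredGraph lay) (assemble j z fun _ => t k) r) l ↔
        Busy lay (transmission (layeredGraph lay) (assemble j z fun _ => t k') r) l) :
    Muffled lay (transmission (layeredGraph lay) (assemble j z t) r) :=
  muffled_of_forall_exists_copy fun _ hl hbusy _ hk =>
    hj.exists_transmitter_assemble agree busy hl ((hj.busy_assemble_iff agree busy hl 0).1 hbusy) hk

end Mixed

section Radio

variable {p T : ℕ}

/-- Which of the layers `0` and `1` contain a transmitter in each of the first `T` rounds. -/
def busyPattern (lay : V → ℕ) (x : V → Strategy model I) (T : ℕ) : Fin T → Fin 2 → Prop :=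
  fun r l => Busy lay (transmission (layeredGraph lay) x r) l

theorem busy_iff_of_busyPattern_eq {x x' : V → Strategy model I}
    (h : busyPattern lay x T = busyPattern lay x' T) {r l : ℕ} (hr : r < T) (hl : l < 2) :
    Busy lay (transmission (layeredGraph lay) x r) l ↔
      Busy lay (transmission (layeredGraph lay) x' r) l :=
  Iff.of_eq (congrFun₂ h ⟨r, hr⟩ ⟨l, hl⟩)

theorem CoreCopies.run_assemble (hj : CoreCopies lay j) {z : B → Strategy (.radioCD p) I}
    {t : Fin 3 → A → Strategy (.radioCD p) I} {c : Fin T → Fin 2 → Prop}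
    (coincide : ∀ k, busyPattern lay (assemble j z fun _ => t k) T = c) {r : ℕ} (hr : r ≤ T)
    {k : Fin 3} {v : V} (hv : AvoidsOtherCopies j k v) :
    run (layeredGraph lay) (assemble j z t) r v =
      run (layeredGraph lay) (assemble j z fun _ => t k) r v := by
  induction r generalizing k v with
  | zero => rfl
  | succ r ih =>
    have agree (k v) (hv : AvoidsOtherCopies j k v) := ih (by omega) hv
    have busy (k k') (l) (hl : l < 2) :=
      busy_iff_of_busyPattern_eq ((coincide k).trans (coincide k').symm) hr hl
    rw [run_succ, run_succ, agree k v hv]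
    congr 1
    refine radioObs_eq_of_muffled (hj.muffled_assemble agree busy)
      (muffled_of_forall_exists_copy fun l hl hbusy k hk =>
        hj.exists_transmitter_of_busy hl hbusy hk)
      (fun l hl => hj.busy_assemble_iff agree busy hl k)
      (transmission_assemble_eq agree hv) fun u hu =>
        transmission_assemble_eq agree (hj.avoidsOtherCopies_of_le_layer k hu)

theorem CoreCopies.receivesNoPacket_assemble (hj : CoreCopies lay j)
    {z : B → Strategy (.radioCD p) I} {t : Fin 3 → A → Strategy (.radioCD p) I}
    {c : Fin T → Fin 2 → Prop}
    (coincide : ∀ k, busyPattern lay (assemble j z fun _ => t k) T = c) {v : V} (hv : lay v = 0) :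
    ReceivesNoPacket (layeredGraph lay) (assemble j z t) T v := by
  refine receivesNoPacket_of_forall_round fun r hr => Muffled.packetless_radioObs ?_ hv
  exact hj.muffled_assemble (fun k v hv => hj.run_assemble coincide hr.le hv) fun k k' l hl =>
    busy_iff_of_busyPattern_eq ((coincide k).trans (coincide k').symm) hr hl

end Radio
end CoreCopies

section NoPacket

variable {V A B S I : Type} [Fintype V] [Finite A] [Finite B] [Countable S] [MeasurableSpace S]
  [MeasurableSingletonClass S] {μ : Measure S} [IsProbabilityMeasure μ]

theorem CoreCopies.le_measureReal_receivesNoPacket_radioCD {lay : V → ℕ} {j : V → (Fin 3 × A) ⊕ B}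
    (hj : CoreCopies lay j) {p : ℕ} (str : S → Strategy (.radioCD p) I) (T : ℕ) :
    ((16 : ℝ) ^ T)⁻¹ ≤ (Measure.pi fun _ => μ).real
      {s : V → S | ∀ v, lay v = 0 → ReceivesNoPacket (layeredGraph lay) (str ∘ s) T v} := by
  have := Fintype.ofFinite A
  have := Fintype.ofFinite B
  have measurable {α : Type} [Countable α] [MeasurableSpace α] [MeasurableSingletonClass α]
      (E : Set α) : MeasurableSet E := E.to_countable.measurableSet
  rw [← (measurePreserving_assemble hj.injective).measureReal_preimage
    (measurable _).nullMeasurableSet]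
  refine le_measureReal_prod (measurable _) fun z => ?_
  let pattern (τ : A → S) : Fin T → Fin 2 → Prop :=
    busyPattern lay (assemble j (str ∘ z) fun _ => str ∘ τ) T
  calc ((16 : ℝ) ^ T)⁻¹ = ((Fintype.card (Fin T → Fin 2 → Prop) : ℝ) ^ 2)⁻¹ := by
        rw [Fintype.card_fun, Fintype.card_fun, Fintype.card_prop, Fintype.card_fin,
          Fintype.card_fin, Nat.cast_pow, ← pow_mul, mul_comm, pow_mul]
        norm_num
    _ ≤ (Measure.pi fun _ => Measure.pi fun _ => μ).real {t | ∃ c, ∀ k, pattern (t k) = c} :=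
        le_measureReal_coincide .of_discrete 2
    _ ≤ _ := by
        refine measureReal_mono ?_
        rintro t ⟨c, hc⟩ v hv
        change ReceivesNoPacket _ (str ∘ assemble j z t) T v
        rw [comp_assemble]
        exact hj.receivesNoPacket_assemble hc hv

theorem CoreCopies.le_measureReal_receivesNoPacket {model : Model} {lay : V → ℕ}
    {j : V → (Fin 3 × A) ⊕ B} (hj : CoreCopies lay j) (str : S → Strategy model I) (T : ℕ) :
    ((16 : ℝ) ^ T)⁻¹ ≤ (Measure.pi fun _ => μ).real
      {s : V → S | ∀ v, lay v = 0 → ReceivesNoPacket (layeredGraph lay) (str ∘ s) T v} := by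
  cases model with
  | radioCD => exact hj.le_measureReal_receivesNoPacket_radioCD str T
  | beep =>
    have always : {s : V → S | ∀ v, lay v = 0 → ReceivesNoPacket (layeredGraph lay) (str ∘ s) T v} =
        Set.univ := Set.eq_univ_of_forall fun s v _ =>
      receivesNoPacket_of_forall_round fun r _ => packetless_beepObs _ _ v
    rw [always, probReal_univ]
    exact inv_le_one_of_one_le₀ (one_le_pow₀ (by norm_num))

end NoPacket

section ElectionProbability

variable {model : Model} {V S I : Type} {str : S → Strategy model I} {G : SimpleGraph V} {T : ℕ}
  {u v : V}

theorem dependsOn_out_run {u w : V} (far : T < G.edist u w) :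
    DependsOn (fun (s : V → S) (_ : Unit) => (str (s u)).out (run G (str ∘ s) T u)) {w}ᶜ := by
  intro s s' h
  have within {x : V} (hx : G.edist u x ≤ T) : s x = s' x :=
    h x fun hxw => far.not_ge (hxw ▸ hx)
  have run_eq : run G (str ∘ s) T u = run G (str ∘ s') T u :=
    run_congr_of_edist_le fun x hx => congrArg str (within hx)
  simp only [run_eq, within (x := u) (by simp)]

variable [Fintype V] [Countable S] [MeasurableSpace S] [MeasurableSingletonClass S] {μ : Measure S}
  [IsProbabilityMeasure μ] {a : ℝ}

theorem measureReal_elected_le_of_lt_edist (hid : ∀ i, μ.real ((fun σ => (str σ).id) ⁻¹' {i}) ≤ a)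
    (far : T + T < G.edist u v) :
    (Measure.pi fun _ => μ).real {s : V → S | Elected G (str ∘ s) T} ≤ Fintype.card V * a := by
  classical
  have far_of_near {w : V} (hw : ¬(T : ℕ∞) < G.edist u w) : (T : ℕ∞) < G.edist v w := by
    by_contra! hv
    exact far.not_ge (SimpleGraph.edist_triangle.trans
      (add_le_add (not_lt.1 hw) (SimpleGraph.edist_comm.trans_le hv)))
  let informant (w : V) : V := if T < G.edist u w then u else v
  have informant_far (w : V) : T < G.edist (informant w) w := by
    simp only [informant]
    split_ifs with hw
    exacts [hw, far_of_near hw]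
  refine (measureReal_mono ?_).trans ((measureReal_guess_le (K := Unit) hid fun w =>
    dependsOn_out_run (str := str) (informant_far w)).trans_eq (by simp))
  rintro s ⟨i, ⟨w, hw⟩, hout⟩
  exact ⟨w, (), (hout (informant w)).trans (congrArg some hw.symm)⟩

theorem measureReal_elected_le_of_receivesNoPacket
    (hid : ∀ i, μ.real ((fun σ => (str σ).id) ⁻¹' {i}) ≤ a) (huv : u ≠ v) :
    (Measure.pi fun _ => μ).real {s : V → S | Elected G (str ∘ s) T} ≤
      Fintype.card V * (4 ^ T * a) + (1 - (Measure.pi fun _ => μ).real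
        {s : V → S | ReceivesNoPacket G (str ∘ s) T u ∧ ReceivesNoPacket G (str ∘ s) T v}) := by
  classical
  let informant (w : V) : V := if w = u then v else u
  have informant_ne (w : V) : informant w ≠ w := by
    simp only [informant]
    split_ifs with hw
    exacts [hw ▸ huv.symm, Ne.symm hw]
  let guess (w : V) (s : V → S) (k : List.Vector (Fin 4) T) : Option I :=
    (str (s (informant w))).out (k.toList.map (bareObs model.Packet))
  have guess_le := measureReal_guess_le (μ := μ) hid (guess := guess) fun w s s' h => by
    simp only [guess, h (informant w) (informant_ne w)]
  rw [card_vector, Fintype.card_fin] at guess_le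
  push_cast at guess_le
  have subset : {s : V → S | Elected G (str ∘ s) T} ⊆
      {s | ∃ w k, guess w s k = some (str (s w)).id} ∪
        {s | ReceivesNoPacket G (str ∘ s) T u ∧ ReceivesNoPacket G (str ∘ s) T v}ᶜ := by
    rintro s ⟨i, ⟨w, hw⟩, hout⟩
    refine or_iff_not_imp_right.2 fun hs => ?_
    have silent : ReceivesNoPacket G (str ∘ s) T (informant w) := by
      simp only [informant]
      split_ifs
      exacts [(not_not.1 hs).2, (not_not.1 hs).1]
    obtain ⟨k, hk⟩ := exists_vector_map_bareObs_eq (length_run T (informant w)) silent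
    exact ⟨w, k, (congrArg _ hk).trans ((hout (informant w)).trans (congrArg some hw.symm))⟩
  rw [← probReal_compl_eq_one_sub (Set.to_countable _).measurableSet]
  exact (measureReal_mono subset).trans
    ((measureReal_union_le _ _).trans (add_le_add_left guess_le _))

theorem CoreCopies.measureReal_elected_le {A B : Type} [Finite A] [Finite B] {lay : V → ℕ}
    {j : V → (Fin 3 × A) ⊕ B} (hj : CoreCopies lay j)
    (hid : ∀ i, μ.real ((fun σ => (str σ).id) ⁻¹' {i}) ≤ a) (huv : u ≠ v) (hu : lay u = 0)
    (hv : lay v = 0) :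
    (Measure.pi fun _ => μ).real {s : V → S | Elected (layeredGraph lay) (str ∘ s) T} ≤
      Fintype.card V * (4 ^ T * a) + (1 - ((16 : ℝ) ^ T)⁻¹) := by
  refine (measureReal_elected_le_of_receivesNoPacket hid huv).trans ?_
  gcongr
  refine (hj.le_measureReal_receivesNoPacket str T).trans (measureReal_mono ?_)
  exact fun s hs => ⟨hs u hu, hs v hv⟩

end ElectionProbability

section HardNetwork

variable {n D m q : ℕ}

/-- The layering of the hard networks. The first `m` nodes consist of consecutive blocks of length
`q`, of which the last may be incomplete; each block has one node in layer `0` and the others in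
layer `1`. The other nodes form a path, one node per layer. -/
def hardLayer (m q : ℕ) (i : Fin n) : ℕ :=
  if i < m then min (i % q) 1 else i - m + 2

/-- The position of a node of the hard network within its block, and the index of the block. -/
def hardCopy (hmq : m ≤ 3 * q) (i : Fin n) : (Fin 3 × Fin q) ⊕ Fin n :=
  if h : i < m then .inl (finProdFinEquiv.symm ⟨i, h.trans_le hmq⟩) else .inr i

theorem hardLayer_le (hD : 1 ≤ D) (hn : n + 1 = m + D) (i : Fin n) : hardLayer m q i ≤ D := by
  unfold hardLayer
  split_ifs <;> omega

theorem exists_hardLayer_eq (hq : 2 ≤ q) (hqm : q ≤ m) (hn : n + 1 = m + D) {l : ℕ}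
    (hl : l ≤ D) : ∃ i : Fin n, hardLayer m q i = l := by
  rcases lt_or_ge l 2 with core | path
  · refine ⟨⟨l, by omega⟩, ?_⟩
    simp only [hardLayer, Nat.mod_eq_of_lt (core.trans_le hq)]
    split_ifs <;> omega
  · refine ⟨⟨m + l - 2, by omega⟩, ?_⟩
    simp only [hardLayer]
    split_ifs <;> omega

theorem hardCopy_eq_inl_iff {hmq : m ≤ 3 * q} {i : Fin n} {k : Fin 3} {a : Fin q} :
    hardCopy hmq i = .inl (k, a) ↔ (i : ℕ) < m ∧ (i : ℕ) = a + q * k := by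
  unfold hardCopy
  split_ifs with h
  · rw [Sum.inl.injEq, Equiv.symm_apply_eq, Fin.ext_iff, finProdFinEquiv_apply_val]
    exact (and_iff_right h).symm
  · simp [h]

theorem coreCopies_hardCopy (hqm : 2 * q ≤ m) (hmq : m ≤ 3 * q) (hmn : m ≤ n) :
    CoreCopies (hardLayer m q) (hardCopy (n := n) hmq) where
  injective i i' h := by
    unfold hardCopy at h
    split_ifs at h
    · exact Fin.ext (Fin.mk.inj (finProdFinEquiv.symm.injective (Sum.inl.inj h)))
    · exact Sum.inr.inj h
  exists_inl_iff i := by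
    unfold hardCopy hardLayer
    split_ifs with h <;> simp
  layer_eq {i i' k l a} hi hi' := by
    obtain ⟨hi, hia⟩ := hardCopy_eq_inl_iff.1 hi
    obtain ⟨hi', hia'⟩ := hardCopy_eq_inl_iff.1 hi'
    rw [hardLayer, hardLayer, if_pos hi, if_pos hi', hia, hia', Nat.add_mul_mod_self_left,
      Nat.add_mul_mod_self_left]
  exists_eq_inl k hk a := by
    have block_le : q * (k : ℕ) ≤ q * 1 := by gcongr; omega
    exact ⟨⟨a + q * k, by omega⟩, hardCopy_eq_inl_iff.2 ⟨by dsimp; omega, rfl⟩⟩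

theorem hardLayer_of_dvd {i : Fin n} (hi : i < m) (hqi : q ∣ i) : hardLayer m q i = 0 := by
  simp [hardLayer, hi, Nat.mod_eq_zero_of_dvd hqi]

end HardNetwork

section FiniteSeed

instance finite_packet (model : Model) : Finite model.Packet := by
  cases model with
  | radioCD p => exact inferInstanceAs (Finite (Fin p → Bool))
  | beep => exact inferInstanceAs (Finite Unit)

instance finite_obs {M : Type} [Finite M] : Finite (Obs M) := by
  refine Finite.of_surjective (Sum.elim Obs.packet (bareObs M)) fun o => ?_
  cases o with
  | own => exact ⟨.inr 0, rfl⟩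
  | silence => exact ⟨.inr 1, rfl⟩
  | packet m => exact ⟨.inl m, rfl⟩
  | collision => exact ⟨.inr 2, rfl⟩
  | beep => exact ⟨.inr 3, rfl⟩

instance isProbabilityMeasure_idLaw (b : ℕ) : IsProbabilityMeasure (idLaw b) :=
  PMF.toMeasure.isProbabilityMeasure _

theorem measureReal_idLaw_singleton {b : ℕ} (i : ID b) : (idLaw b).real {i} = ((2 : ℝ) ^ b)⁻¹ := by
  rw [idLaw, measureReal_def, PMF.toMeasure_apply_singleton _ _ (measurableSet_singleton i)]
  simp

/-- An identifier together with the actions and the outputs after all lists of at most `T`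
observations. Unlike a random tape, this is a random variable with finitely many values. -/
@[ext]
structure FiniteSeed (model : Model) (b T : ℕ) where
  id : ID b
  act : {l : List (Obs model.Packet) // l.length ≤ T} → Option model.Packet
  out : {l : List (Obs model.Packet) // l.length ≤ T} → Option (ID b)

variable {model : Model} {b T : ℕ}

instance : MeasurableSpace (FiniteSeed model b T) := ⊤

instance : DiscreteMeasurableSpace (FiniteSeed model b T) := ⟨fun _ => trivial⟩

instance : Finite (FiniteSeed model b T) :=
  have : Finite {l : List (Obs model.Packet) // l.length ≤ T} :=
    (List.finite_length_le (Obs model.Packet) T).to_subtype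
  .of_injective (fun σ => (σ.id, σ.act, σ.out)) fun _ _ h => by simpa [FiniteSeed.ext_iff] using h

/-- The strategy encoded by a finite seed, which becomes inactive after more than `T` rounds. -/
def FiniteSeed.strategy (σ : FiniteSeed model b T) : Strategy model (ID b) where
  id := σ.id
  act l := if h : l.length ≤ T then σ.act ⟨l, h⟩ else none
  out l := if h : l.length ≤ T then σ.out ⟨l, h⟩ else none

namespace Protocol

/-- The strategy of a node with identifier `x.1` and tape `x.2`. -/
def strategy (P : Protocol model b) (x : ID b × P.Tape) : Strategy model (ID b) where
  id := x.1
  act := P.act x.1 x.2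
  out := P.out x.1 x.2

/-- The part of a node's identifier and tape that matters during the first `T` rounds. -/
def finiteSeed (P : Protocol model b) (T : ℕ) (x : ID b × P.Tape) : FiniteSeed model b T where
  id := x.1
  act l := P.act x.1 x.2 l
  out l := P.out x.1 x.2 l

theorem measurable_finiteSeed (P : Protocol model b) : Measurable (P.finiteSeed T) := by
  refine measurable_to_countable' fun σ => ?_
  have preimage_eq : P.finiteSeed T ⁻¹' {σ} =
      {σ.id} ×ˢ ⋂ l, {ω | P.act σ.id ω l.1 = σ.act l} ∩ {ω | P.out σ.id ω l.1 = σ.out l} := by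
    ext ⟨i, ω⟩
    simp only [Set.mem_preimage, Set.mem_singleton_iff, FiniteSeed.ext_iff, finiteSeed,
      Set.mem_prod, Set.mem_iInter, Set.mem_inter_iff, Set.mem_ofPred_eq, forall_and]
    refine and_congr_right ?_
    rintro rfl
    simp only [funext_iff]
  rw [preimage_eq]
  exact (measurableSet_singleton _).prod (.iInter fun l =>
    (P.measurable_act _ _ _).inter (P.measurable_out _ _ _))

/-- The law of the finite seed of a node. -/
noncomputable def finiteSeedLaw (P : Protocol model b) (T : ℕ) : Measure (FiniteSeed model b T) :=
  ((idLaw b).prod P.law).map (P.finiteSeed T)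

instance (P : Protocol model b) : IsProbabilityMeasure (P.finiteSeedLaw T) :=
  Measure.isProbabilityMeasure_map P.measurable_finiteSeed.aemeasurable

theorem measureReal_finiteSeedLaw_id (P : Protocol model b) (T : ℕ) (i : ID b) :
    (P.finiteSeedLaw T).real ((fun σ => σ.strategy.id) ⁻¹' {i}) = ((2 : ℝ) ^ b)⁻¹ := by
  have preimage_eq : P.finiteSeed T ⁻¹' ((fun σ => σ.strategy.id) ⁻¹' {i}) = {i} ×ˢ Set.univ := by
    ext x
    simp [finiteSeed, FiniteSeed.strategy]
  rw [finiteSeedLaw, map_measureReal_apply P.measurable_finiteSeed .of_discrete, preimage_eq,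
    measureReal_prod_prod, measureReal_idLaw_singleton, probReal_univ, mul_one]

variable {V : Type}

theorem view_univ (P : Protocol model b) (G : SimpleGraph V) (s : V → ID b × P.Tape) (r : ℕ)
    (v : V) : P.view G Set.univ s r v = some (run G (P.strategy ∘ s) r v) := by
  induction r generalizing v with
  | zero => simp [view, run]
  | succ r ih => simp [view, run, ih, strategy]

theorem elects_univ_iff (P : Protocol model b) (G : SimpleGraph V) (s : V → ID b × P.Tape) :
    P.Elects G Set.univ T s ↔ Elected G (fun v => (P.finiteSeed T (s v)).strategy) T := by
  have run_eq : run G (P.strategy ∘ s) T = run G (fun v => (P.finiteSeed T (s v)).strategy) T :=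
    run_congr_of_length_lt le_rfl fun v l hl => by
      simp [strategy, finiteSeed, FiniteSeed.strategy, hl.le]
  have output_eq (v : V) : P.output G Set.univ s T v = (P.finiteSeed T (s v)).strategy.out
      (run G (fun v => (P.finiteSeed T (s v)).strategy) T v) := by
    rw [output, view_univ, run_eq]
    simp [finiteSeed, FiniteSeed.strategy, length_run]
  simp only [Elects, Elected, output_eq]
  rfl

theorem SolvesLeaderElection.le_measureReal_elected {P : Protocol model b} {wake : WakeUp}
    {n D : ℕ} {c : ℝ} (hP : P.SolvesLeaderElection wake n D T c) {G : SimpleGraph (Fin n)}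
    (hG : G.Connected) (hdiam : G.diam = D) :
    1 - (n : ℝ) ^ (-c) ≤ (Measure.pi fun _ => P.finiteSeedLaw T).real
      {s : Fin n → FiniteSeed model b T | Elected G (FiniteSeed.strategy ∘ s) T} := by
  have allowed : wake.Allows (Set.univ : Set (Fin n)) := by
    have := hG.nonempty
    cases wake with
    | synchronous => rfl
    | arbitrary => exact Set.univ_nonempty
  have preserving := measurePreserving_pi (fun _ : Fin n => (idLaw b).prod P.law)
    (fun _ => P.finiteSeedLaw T) fun _ => P.measurable_finiteSeed.measurePreserving _
  rw [← preserving.measureReal_preimage (Set.to_countable _).measurableSet.nullMeasurableSet]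
  exact (hP G hG hdiam Set.univ allowed).trans_eq
    (congrArg _ (Set.ext fun s => P.elects_univ_iff G s))

end Protocol
end FiniteSeed

section LowerBounds

theorem one_sub_pow_mul_one_add_le_one {x : ℝ} (hx0 : 0 ≤ x) (hx1 : x ≤ 1) (m : ℕ) :
    (1 - x) ^ m * (1 + m * x) ≤ 1 := by
  have : 0 ≤ 1 - x := sub_nonneg.2 hx1
  calc (1 - x) ^ m * (1 + m * x) ≤ (1 - x) ^ m * (1 + x) ^ m := by
        gcongr
        exact one_add_mul_le_pow (by linarith) m
    _ = (1 - x ^ 2) ^ m := by rw [← mul_pow]; ring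
    _ ≤ 1 := pow_le_one₀ (by nlinarith) (by nlinarith)

theorem IDsUniqueWHP.mul_inv_two_pow_le {n b : ℕ} {c : ℝ} (h : IDsUniqueWHP n b c) (hn : 2 ≤ n)
    (hnc : (n : ℝ) ^ (-c) ≤ 1 / 2) : n * ((2 : ℝ) ^ b)⁻¹ ≤ 4 * (n : ℝ) ^ (-c) := by
  obtain ⟨m, rfl⟩ : ∃ m, n = m + 1 := ⟨n - 1, by omega⟩
  set ε := ((m + 1 : ℕ) : ℝ) ^ (-c)
  set a := ((2 : ℝ) ^ b)⁻¹
  have ha0 : 0 ≤ a := by positivity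
  have ha1 : a ≤ 1 := inv_le_one_of_one_le₀ (one_le_pow₀ (by norm_num))
  have hm : (1 : ℝ) ≤ m := by exact_mod_cast (by omega : 1 ≤ m)
  have birthday : 1 - ε ≤ (1 - a) ^ m :=
    h.trans (measureReal_injective_le (fun i => (measureReal_idLaw_singleton i).ge) m)
  have collision_le : (1 - ε) * (1 + m * a) ≤ 1 :=
    (mul_le_mul_of_nonneg_right birthday (by positivity)).trans
      (one_sub_pow_mul_one_add_le_one ha0 ha1 m)
  have : m * a ≤ 2 * ε := by nlinarith [mul_nonneg (m.cast_nonneg (α := ℝ)) ha0]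
  push_cast
  nlinarith

namespace Protocol.SolvesLeaderElection

variable {model : Model} {b T n D : ℕ} {c : ℝ} {P : Protocol model b} {wake : WakeUp}

theorem one_sub_rpow_le_of_two_mul_lt (hP : P.SolvesLeaderElection wake n D T c) (hD : 1 ≤ D)
    (hDn : D < n) (hTD : 2 * T < D) : 1 - (n : ℝ) ^ (-c) ≤ n * ((2 : ℝ) ^ b)⁻¹ := by
  let lay (i : Fin n) : ℕ := min i D
  have hle (i : Fin n) : lay i ≤ D := min_le_right _ _
  have hsurj (l : ℕ) (hl : l ≤ D) : ∃ i, lay i = l := ⟨⟨l, by omega⟩, min_eq_left hl⟩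
  obtain ⟨u, hu⟩ := hsurj 0 D.zero_le
  obtain ⟨v, hv⟩ := hsurj D le_rfl
  have far : (T + T : ℕ∞) < (layeredGraph lay).edist u v := by
    have le_edist := layer_le_add_edist (lay := lay) u v
    rw [hu, hv, Nat.cast_zero, zero_add] at le_edist
    exact lt_of_lt_of_le (by exact_mod_cast (by omega : T + T < D)) le_edist
  have le_elected := hP.le_measureReal_elected (connected_layeredGraph hD hle hsurj)
    (diam_layeredGraph hD hle hsurj)
  simpa only [Fintype.card_fin] using le_elected.trans
    (measureReal_elected_le_of_lt_edist (fun i => (P.measureReal_finiteSeedLaw_id T i).le) far)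

theorem one_sub_rpow_le_of_add_three_le (hP : P.SolvesLeaderElection wake n D T c) (hD : 1 ≤ D)
    (hDn : D + 3 ≤ n) :
    1 - (n : ℝ) ^ (-c) ≤ n * (4 ^ T * ((2 : ℝ) ^ b)⁻¹) + (1 - ((16 : ℝ) ^ T)⁻¹) := by
  obtain ⟨m, hm⟩ : ∃ m, n + 1 = m + D := ⟨n + 1 - D, by omega⟩
  obtain ⟨q, hq, hqm, hmq⟩ : ∃ q, 2 ≤ q ∧ 2 * q ≤ m ∧ m ≤ 3 * q := ⟨m / 2, by omega⟩
  have hsurj (l : ℕ) (hl : l ≤ D) := exists_hardLayer_eq hq (by omega) hm hl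
  let u : Fin n := ⟨0, by omega⟩
  let v : Fin n := ⟨q, by omega⟩
  have elected_le := (coreCopies_hardCopy hqm hmq (by omega)).measureReal_elected_le (T := T)
    (fun i => (P.measureReal_finiteSeedLaw_id T i).le)
    (Fin.ne_of_val_ne (by omega : 0 ≠ q) : u ≠ v)
    (hardLayer_of_dvd (by omega : 0 < m) (dvd_zero q)) (hardLayer_of_dvd (by omega : q < m) dvd_rfl)
  rw [Fintype.card_fin] at elected_le
  exact (hP.le_measureReal_elected (connected_layeredGraph hD (hardLayer_le hD hm) hsurj)
    (diam_layeredGraph hD (hardLayer_le hD hm) hsurj)).trans elected_le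

theorem diameter_le (hP : P.SolvesLeaderElection wake n D T c) (hIDs : IDsUniqueWHP n b c)
    (hD : 1 ≤ D) (hDn : D < n) (hnc : (n : ℝ) ^ (-c) ≤ 1 / 25) : D ≤ 2 * T := by
  by_contra! hTD
  linarith [hP.one_sub_rpow_le_of_two_mul_lt hD hDn hTD,
    hIDs.mul_inv_two_pow_le (by omega) (by linarith)]

theorem rpow_le (hP : P.SolvesLeaderElection wake n D T c) (hIDs : IDsUniqueWHP n b c)
    (hD : 1 ≤ D) (hDn : D + 3 ≤ n) (hnc : (n : ℝ) ^ (-c) ≤ 1 / 25) :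
    (n : ℝ) ^ c ≤ 5 * 64 ^ T := by
  have ids := hIDs.mul_inv_two_pow_le (by omega) (by linarith)
  have elected := hP.one_sub_rpow_le_of_add_three_le hD hDn
  have h4 : (1 : ℝ) ≤ 4 ^ T := one_le_pow₀ (by norm_num)
  have hn : (0 : ℝ) < n := by exact_mod_cast (by omega : 0 < n)
  have inv_le : ((16 : ℝ) ^ T)⁻¹ ≤ 5 * 4 ^ T * ((n : ℝ) ^ c)⁻¹ := by
    rw [← Real.rpow_neg hn.le]
    nlinarith [Real.rpow_pos_of_pos hn (-c)]
  rw [← div_eq_mul_inv, inv_le_comm₀ (by positivity) (by positivity), inv_div,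
    div_le_iff₀ (by positivity)] at inv_le
  calc (n : ℝ) ^ c ≤ 16 ^ T * (5 * 4 ^ T) := inv_le
    _ = 5 * 64 ^ T := by rw [mul_left_comm, ← mul_pow]; norm_num

theorem mul_log_le (hP : P.SolvesLeaderElection wake n D T c) (hIDs : IDsUniqueWHP n b c)
    (hD : 1 ≤ D) (hDn : D + 3 ≤ n) (hnc : (n : ℝ) ^ (-c) ≤ 1 / 25) :
    c * Real.log n ≤ 10 * T := by
  have hn : (0 : ℝ) < n := by exact_mod_cast (by omega : 0 < n)
  have log_le : c * Real.log n ≤ Real.log 5 + T * Real.log 64 := by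
    rw [← Real.log_rpow hn, ← Real.log_pow, ← Real.log_mul (by norm_num) (by positivity)]
    exact Real.log_le_log (by positivity) (hP.rpow_le hIDs hD hDn hnc)
  have two_mul_log_five_le : 2 * Real.log 5 ≤ c * Real.log n := by
    have := Real.log_le_log (by positivity) hnc
    rw [Real.log_rpow hn, one_div, Real.log_inv, show (25 : ℝ) = 5 ^ 2 by norm_num, Real.log_pow]
      at this
    push_cast at this
    linarith
  have log_64 : Real.log 64 = 6 * Real.log 2 := by
    rw [show (64 : ℝ) = 2 ^ 6 by norm_num, Real.log_pow]
    norm_num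
  nlinarith [Real.log_two_lt_d9, T.cast_nonneg (α := ℝ)]

theorem log_le (hP : P.SolvesLeaderElection wake n D T c) (hIDs : IDsUniqueWHP n b c) (hc : 0 < c)
    (hD : 1 ≤ D) (hDn : D < n) (hnc : (n : ℝ) ^ (-c) ≤ 1 / 25) :
    Real.log n ≤ (3 + 10 / c) * T := by
  rcases le_or_gt (D + 3) n with wide | narrow
  · calc Real.log n ≤ 10 * T / c := by
          rw [le_div_iff₀' hc]
          exact hP.mul_log_le hIDs hD wide hnc
      _ ≤ (3 + 10 / c) * T := by
          rw [mul_div_right_comm]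
          gcongr
          linarith
  · have hn : (n : ℝ) ≤ 3 * T + 1 := by
      have := hP.diameter_le hIDs hD hDn hnc
      exact_mod_cast (by omega : n ≤ 3 * T + 1)
    calc Real.log n ≤ n - 1 := Real.log_le_sub_one_of_pos (by exact_mod_cast (by omega : 0 < n))
      _ ≤ 3 * T := by linarith
      _ ≤ (3 + 10 / c) * T := by
          gcongr
          linarith [div_pos (by norm_num : (0 : ℝ) < 10) hc]

end Protocol.SolvesLeaderElection
end LowerBounds

end RadioNetwork

theorem mainTheorem7 (c : ℝ) (hc : 0 < c) :
    ∃ κ : ℝ, 0 < κ ∧ ∃ n₀ : ℕ,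
      ∀ (model : RadioNetwork.Model) (wake : RadioNetwork.WakeUp) (n D b T : ℕ),
        n₀ ≤ n → 1 ≤ D → D < n → RadioNetwork.IDsUniqueWHP n b c →
        ∀ P : RadioNetwork.Protocol model b, P.SolvesLeaderElection wake n D T c →
          κ * ((D : ℝ) + Real.log n) ≤ (T : ℝ) := by
  obtain ⟨n₀, hn₀⟩ : ∃ n₀ : ℕ, ∀ n ≥ n₀, (n : ℝ) ^ (-c) ≤ 1 / 25 :=
    Filter.eventually_atTop.1 <| ((tendsto_rpow_neg_atTop hc).comp
      tendsto_natCast_atTop_atTop).eventually_le_const (by norm_num)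
  refine ⟨(5 + 10 / c)⁻¹, by positivity, n₀, fun model wake n D b T hn hD hDn hIDs P hP => ?_⟩
  have diameter_le : (D : ℝ) ≤ 2 * T := by
    exact_mod_cast hP.diameter_le hIDs hD hDn (hn₀ n hn)
  have log_le : Real.log n ≤ (3 + 10 / c) * T := hP.log_le hIDs hc hD hDn (hn₀ n hn)
  rw [inv_mul_le_iff₀ (by positivity)]
  linarith
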